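/- **Definitions.** Let $\mathcal A$ be a finite alphabet with the discrete topology, and let $\mathcal A^{\mathbb Z}$ carry the product topology and the shift map $\sigma(x)_i = x_{i+1}$. For a finite list $L$ of words over $\mathcal A$, the *renewal system* $\mathsf X(L) \subseteq \mathcal A^{\mathbb Z}$ is the set of bi-infinite sequences all of whose finite factors are factors of concatenations of words from $L$. A shift space $X \subseteq \mathcal A^{\mathbb Z}$ is an *SFT* if it is the set of all sequences in $\mathcal A^{\mathbb Z}$ that contain no word from some finite set of forbidden words. Two shift spaces are *conjugate* if there is a bijective, continuous, shift-commuting map from one to the other. For an $n \times n$ matrix $A$ over the non-negative integers, $\mathsf X_A$ denotes the edge shift of the finite directed graph with adjacency matrix $A$, and $BF(A) = \mathbb Z^n / \mathbb Z^n(\mathrm{Id} - A)$ is its Bowen–Franks group. An SFT $X$ is said to have cyclic Bowen–Franks group and determinant $k$ if $X$ is conjugate to an edge shift $\mathsf X_A$ for which $BF(A)$ is cyclic and $\det(\mathrm{Id}-A) = k$. *Fragmenting* letters of a list means replacing each such letter $x$ by new letters $x_1, \dots, x_m$, and each word by all words obtained from it by replacing each occurrence of $x$ by any one of $x_1, \dots,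 x_m$ (independently for each occurrence). **Theorem.** (i) For every $k \in \mathbb Z$ there is a finite list $L$ of words over a finite alphabet such that $\mathsf X(L)$ is an SFT with cyclic Bowen–Franks group and determinant $k$. (ii) More precisely, for all integers $p, q \geq 1$ let $L_{p,q}$ be the (finite) list obtained from $$\{\, a,\ \alpha,\ \tilde\alpha,\ \gamma,\ \alpha\gamma\beta,\ \beta\tilde\alpha\gamma \,\}$$ by fragmenting $a$ into $p$ letters and $\gamma$ into $q$ letters (and leaving the letters $\alpha, \tilde\alpha, \beta$ as they are). Then $\mathsf X(L_{p,q})$ is an SFT with cyclic Bowen–Franks group and determinant $q^2 - 3q - p - 1$; and every $k \in \mathbb Z$ is of the form $q^2 - 3q - p - 1$ with integers $p, q \geq 1$. -/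

import Mathlib

open SymbolicDynamics.FullShift

namespace RenewalSystems

/-- The finite word `w` occurs in the bi-infinite sequence `x`. -/
def Occurs {𝒜 : Type*} (w : List 𝒜) (x : ℤ → 𝒜) : Prop :=
  ∃ i : ℤ, ∀ j : Fin w.length, x (i + (j : ℤ)) = w.get j

/-- A word occurs in a shifted sequence iff it occurs in the sequence. -/
theorem occurs_shift {𝒜 : Type*} (w : List 𝒜) (x : ℤ → 𝒜) (g : ℤ) :
    Occurs w (shift g x) ↔ Occurs w x := by
  constructor
  · rintro ⟨i, hi⟩
    exact ⟨g + i, fun j => by rw [add_assoc]; exact hi j⟩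
  · rintro ⟨i, hi⟩
    refine ⟨-g + i, fun j => ?_⟩
    have h : shift g x (-g + i + (j : ℤ)) = x (i + (j : ℤ)) := by
      rw [shift_apply]; congr 1; ring
    rw [h]; exact hi j

/-- The set of sequences containing a given word is open. -/
theorem isOpen_occurs {𝒜 : Type*} [TopologicalSpace 𝒜] [DiscreteTopology 𝒜] (w : List 𝒜) :
    IsOpen {x : ℤ → 𝒜 | Occurs w x} := by
  have h : {x : ℤ → 𝒜 | Occurs w x} =
      ⋃ i : ℤ, ⋂ j : Fin w.length, (fun x : ℤ → 𝒜 => x (i + (j : ℤ))) ⁻¹' {w.get j} := by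
    ext x; simp [Occurs]
  rw [h]
  exact isOpen_iUnion fun i => isOpen_iInter_of_finite fun j =>
    (isOpen_discrete _).preimage (continuous_apply _)

/-- `X` is a shift of finite type: it is the set of all bi-infinite sequences that contain no
word from some finite set `F` of forbidden words. -/
def IsSFT {𝒜 : Type*} [TopologicalSpace 𝒜] (X : Subshift 𝒜 ℤ) : Prop :=
  ∃ F : Set (List 𝒜), F.Finite ∧ X.carrier = {x | ∀ w ∈ F, ¬ Occurs w x}

/-- `X` and `Y` are conjugate: there is a bijective, continuous, shift-commuting map `X → Y`. -/
def Conjugate {𝒜 ℬ : Type*} [TopologicalSpace 𝒜] [TopologicalSpace ℬ]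
    (X : Subshift 𝒜 ℤ) (Y : Subshift ℬ ℤ) : Prop :=
  ∃ φ : X.carrier → Y.carrier, Continuous φ ∧ Function.Bijective φ ∧
    ∀ x : X.carrier, (φ ⟨shift 1 x.1, X.mapsTo 1 x.2⟩ : ℤ → ℬ) = shift 1 (φ x : ℤ → ℬ)

/-- `ℬ(L)`: the factors of the elements of `L*`. -/
def factors {𝒜 : Type*} (L : Set (List 𝒜)) : Set (List 𝒜) :=
  {w | ∃ v : List 𝒜, (∃ l : List (List 𝒜), (∀ u ∈ l, u ∈ L) ∧ v = l.flatten) ∧ w <:+: v}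

/-- The renewal system `X(L)` generated by `L`: the bi-infinite sequences all of whose finite
factors belong to `ℬ(L)`. -/
def renewalSystem {𝒜 : Type*} [TopologicalSpace 𝒜] [DiscreteTopology 𝒜] (L : Set (List 𝒜)) :
    Subshift 𝒜 ℤ where
  carrier := {x | ∀ w, Occurs w x → w ∈ factors L}
  isClosed := by
    have h : {x : ℤ → 𝒜 | ∀ w, Occurs w x → w ∈ factors L} =
        ⋂ w : List 𝒜, ⋂ _ : w ∉ factors L, {x : ℤ → 𝒜 | Occurs w x}ᶜ := by
      ext x
      simp only [Set.mem_ofPred_eq, Set.mem_iInter, Set.mem_compl_iff]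
      exact forall_congr' fun w => not_imp_not.symm
    rw [h]
    exact isClosed_iInter fun w => isClosed_iInter fun _ => (isOpen_occurs w).isClosed_compl
  mapsTo := fun g _ hx w hw => hx w ((occurs_shift w _ g).1 hw)

/-- The edges of the finite directed graph with vertex set `V` and adjacency matrix `A`: there are
`A i j` edges from `i` to `j`. -/
abbrev Edge {V : Type*} (A : Matrix V V ℕ) : Type _ :=
  Σ p : V × V, Fin (A p.1 p.2)

/-- The edge shift of the finite directed graph with adjacency matrix `A`: the bi-infinite
sequences of edges such that each edge ends where the next one starts. -/
def edgeShift {V : Type*} (A : Matrix V V ℕ) : Subshift (Edge A) ℤ where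
  carrier := {x | ∀ i : ℤ, (x i).1.2 = (x (i + 1)).1.1}
  isClosed := by
    have h : {x : ℤ → Edge A | ∀ i : ℤ, (x i).1.2 = (x (i + 1)).1.1} =
        ⋂ i : ℤ, (fun x : ℤ → Edge A => (x i, x (i + 1))) ⁻¹'
          {q : Edge A × Edge A | q.1.1.2 = q.2.1.1} := by
      ext x; simp
    rw [h]
    exact isClosed_iInter fun i => (isClosed_discrete _).preimage
      ((continuous_apply i).prodMk (continuous_apply (i + 1)))
  mapsTo := fun g x hx i => by
    have h := hx (g + i)
    rwa [add_assoc] at h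

/-- The matrix `Id - A` over the integers. -/
def idSub {V : Type*} [DecidableEq V] (A : Matrix V V ℕ) : Matrix V V ℤ :=
  1 - A.map (fun n : ℕ => (n : ℤ))

/-- The Bowen–Franks group `ℤⁿ / ℤⁿ(Id - A)` (row vectors). -/
abbrev BowenFranks {V : Type*} [Fintype V] [DecidableEq V] (A : Matrix V V ℕ) : Type _ :=
  (V → ℤ) ⧸ LinearMap.range (Matrix.vecMulLinear (idSub A))

/-- `X` has cyclic Bowen–Franks group and determinant `k`: `X` is conjugate to the edge shift of a
finite directed graph whose adjacency matrix `A` satisfies that `BF(A)` is cyclic and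
`det (Id - A) = k`. -/
def HasCyclicBFAndDet {𝒜 : Type*} [TopologicalSpace 𝒜] (X : Subshift 𝒜 ℤ) (k : ℤ) : Prop :=
  ∃ (n : ℕ) (A : Matrix (Fin n) (Fin n) ℕ),
    Conjugate X (edgeShift A) ∧ IsAddCyclic (BowenFranks A) ∧ (idSub A).det = k

/-- The alphabet `{a, α, α̃, β, γ}`. -/
inductive Letter : Type
  | a
  | α
  | αt
  | β
  | γ

/-- The list `{a, α, α̃, γ, αγβ, βα̃γ}`. -/
def baseList : Set (List Letter) :=
  {[.a], [.α], [.αt], [.γ], [.α, .γ, .β], [.β, .αt, .γ]}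

/-- The alphabet obtained by fragmenting each letter `l` into `m l` letters. -/
abbrev Fragmented {𝒜 : Type*} (m : 𝒜 → ℕ) : Type _ :=
  Σ l : 𝒜, Fin (m l)

/-- The fragmentation of the list `L`: the preimage of `L` under the map on words that
forgets the fragmentation. -/
def fragment {𝒜 : Type*} (m : 𝒜 → ℕ) (L : Set (List 𝒜)) : Set (List (Fragmented m)) :=
  {w | w.map Sigma.fst ∈ L}

/-- The multiplicities: `a` is fragmented into `p` letters, `γ` into `q` letters, and
`α`, `α̃`, `β` are kept as single letters. -/
def mult (p q : ℕ) : Letter → ℕ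
  | .a => p
  | .γ => q
  | _ => 1

end RenewalSystems

/-!
The words of the list which contain `β` are `αγβ` and `βα̃γ`, each of the letters other than `β` is a
word by itself, and two occurrences of the long words in a sequence overlap only if they share their
letter `β`. All of this depends on the letters before fragmentation only. Hence a sequence can be
cut into words of the list as soon as each of its letters `β` is preceded by `αγ` or followed by
`α̃γ` (`Admissible`), and this condition is of finite type (`isSFT_renewalSystem`).

Reading an admissible sequence from left to right, one needs to remember only whether the last
letters were `α` or `αγ`, and whether a `β` that was not preceded by `αγ` still waits for its `α̃γ`.
This is a deterministic automaton with five states (`step`), whose state is moreover determined by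
the last four letters (`state`). For such an automaton, reading off the states is a conjugacy onto
the edge shift of the matrix that counts its transitions
(`conjugate_edgeShift_transitionMatrix`). For the automaton `step` this is a `5 × 5` matrix;
its determinant is computed directly, and the relations given by its rows express all basis
vectors of `ℤ⁵` as multiples of the first one, so that its Bowen–Franks group is cyclic.
-/

namespace RenewalSystems

/-! ### Edge shifts of deterministic automata -/

section Automaton

variable {B V : Type*}

/-- The number of letters that take the deterministic automaton `δ` from state `i` to state `j`;
the value `none` of `δ` means that the letter cannot be read. -/
noncomputable def transitionMatrix (δ : V → B → Option V) : Matrix V V ℕ :=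
  fun i j => Nat.card {b // δ i b = some j}

/-- A transition of the automaton amounts to an edge of the graph of its transition matrix. -/
noncomputable def transitionEquiv [Finite B] (δ : V → B → Option V) :
    (Σ p : V × V, {b // δ p.1 b = some p.2}) ≃ Edge (transitionMatrix δ) :=
  Equiv.sigmaCongrRight fun p => Finite.equivFin {b // δ p.1 b = some p.2}

/-- If the sequences of `X` are the labels of the bi-infinite paths of a deterministic automaton,
and if the path is a continuous function of its label, then `X` is conjugate to the edge shift of
the transition matrix. -/
theorem conjugate_edgeShift_transitionMatrix [Finite B] [TopologicalSpace B] [DiscreteTopology B]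
    [TopologicalSpace V] [DiscreteTopology V] (δ : V → B → Option V) (X : Subshift B ℤ)
    (s : (ℤ → B) → V) (hs : Continuous s)
    (hstep : ∀ x ∈ X.carrier, ∀ i : ℤ, δ (s (shift i x)) (x i) = some (s (shift (i + 1) x)))
    (hpath : ∀ (x : ℤ → B) (t : ℤ → V), (∀ i, δ (t i) (x i) = some (t (i + 1))) →
      x ∈ X.carrier ∧ ∀ i, t i = s (shift i x)) :
    Conjugate X (edgeShift (transitionMatrix δ)) := by
  -- The edge at time `i` only depends on the states before and after it and on the letter read.
  let e : {r : (V × V) × B // δ r.1.1 r.2 = some r.1.2} → Edge (transitionMatrix δ) :=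
    fun r => transitionEquiv δ ⟨r.1.1, r.1.2, r.2⟩
  let φ : X.carrier → (edgeShift (transitionMatrix δ)).carrier := fun x =>
    ⟨fun i => e ⟨((s (shift i x.1), s (shift (i + 1) x.1)), x.1 i), hstep x.1 x.2 i⟩,
      fun i => rfl⟩
  refine ⟨φ, ?_, ⟨?_, ?_⟩, ?_⟩
  · refine Continuous.subtype_mk (continuous_pi fun i => ?_) _
    refine (continuous_of_discreteTopology (f := e)).comp (Continuous.subtype_mk ?_ _)
    exact ((hs.comp ((continuous_shift i).comp continuous_subtype_val)).prodMk
      (hs.comp ((continuous_shift (i + 1)).comp continuous_subtype_val))).prodMk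
      ((continuous_apply i).comp continuous_subtype_val)
  · intro x y hxy
    refine Subtype.ext (funext fun i => ?_)
    have h := (transitionEquiv δ).injective (congrFun (congrArg Subtype.val hxy) i)
    exact congrArg (fun z : Σ p : V × V, {b // δ p.1 b = some p.2} => (z.2 : B)) h
  · rintro ⟨y, hy⟩
    let z := fun i => (transitionEquiv δ).symm (y i)
    have hz : ∀ i, (z i).1.2 = (z (i + 1)).1.1 := hy
    obtain ⟨hx, ht⟩ := hpath (fun i => (z i).2) (fun i => (z i).1.1) fun i => by
      rw [← hz]; exact (z i).2.2
    refine ⟨⟨_, hx⟩, Subtype.ext (funext fun i => ?_)⟩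
    change transitionEquiv δ _ = y i
    rw [← (transitionEquiv δ).apply_symm_apply (y i)]
    congr 1
    refine Sigma.ext (Prod.ext (ht i).symm ?_) ?_
    · exact (ht (i + 1)).symm.trans (hz i).symm
    · refine (Subtype.heq_iff_coe_eq fun b => ?_).2 rfl
      change δ (s _) b = some (s _) ↔ δ (z i).1.1 b = some (z i).1.2
      rw [hz i, ← ht i, ← ht (i + 1)]
  · intro x
    funext i
    have h : ∀ j : ℤ, shift j (shift 1 x.1) = shift (1 + j) x.1 := fun j => by
      funext m
      simp only [shift_apply, add_assoc]
    have h' : ∀ (r r' : {r : (V × V) × B // δ r.1.1 r.2 = some r.1.2}), r.1 = r'.1 → e r = e r' :=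
      fun r r' hr => congrArg e (Subtype.ext hr)
    refine h' _ _ (Prod.ext (Prod.ext (congrArg s (h i)) ?_) rfl)
    exact (congrArg s (h (i + 1))).trans
      (congrArg (fun j => s (shift j x.1)) (add_assoc 1 i 1).symm)

end Automaton

/-! ### Words read off a sequence -/

section Window

variable {𝒜 : Type*}

/-- The word `x i, …, x (i + n - 1)`. -/
def window (x : ℤ → 𝒜) (i : ℤ) (n : ℕ) : List 𝒜 :=
  List.ofFn fun j : Fin n => x (i + (j : ℤ))

theorem occurs_window (x : ℤ → 𝒜) (i : ℤ) (n : ℕ) : Occurs (window x i n) x :=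
  ⟨i, fun j => (List.get_ofFn (fun k : Fin n => x (i + (k : ℤ))) j).symm⟩

theorem occurs_iff_eq_window (w : List 𝒜) (x : ℤ → 𝒜) :
    Occurs w x ↔ ∃ i, w = window x i w.length := by
  refine ⟨fun ⟨i, hi⟩ => ⟨i, ?_⟩, fun ⟨i, hi⟩ => hi ▸ occurs_window x i _⟩
  simp [window, hi]

theorem window_add (x : ℤ → 𝒜) (i : ℤ) (m n : ℕ) :
    window x i (m + n) = window x i m ++ window x (i + m) n := by
  simp [window, List.ofFn_add, add_assoc]

theorem window_infix (x : ℤ → 𝒜) (i : ℤ) (m n k : ℕ) (h : m + n ≤ k) :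
    window x (i + m) n <:+: window x i k := by
  obtain ⟨c, rfl⟩ := Nat.exists_eq_add_of_le h
  exact ⟨window x i m, window x (i + (m + n : ℕ)) c, by simp only [window_add]⟩

end Window

/-! ### The renewal system as a shift of finite type -/

instance : DecidableEq Letter := fun x y => by
  cases x <;> cases y <;> first | exact isTrue rfl | exact isFalse nofun

instance : Fintype Letter :=
  ⟨{.a, .α, .αt, .β, .γ}, by rintro ⟨⟩ <;> decide⟩

/-- Every letter `β` is preceded by `αγ` or followed by `α̃γ`. -/
def Admissible (y : ℤ → Letter) : Prop :=
  ∀ i, y i = .β →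
    (y (i - 2) = .α ∧ y (i - 1) = .γ) ∨ (y (i + 1) = .αt ∧ y (i + 2) = .γ)

/-- In a concatenation of words of the list, each `β` is preceded by `αγ` or followed by `α̃γ`,
since these letters belong to the same word as the `β`. -/
theorem suffix_or_prefix_of_flatten_eq (l : List (List Letter)) (hl : ∀ u ∈ l, u ∈ baseList)
    (v w : List Letter) (h : l.flatten = v ++ .β :: w) :
    [.α, .γ] <:+ v ∨ [.αt, .γ] <+: w := by
  induction l generalizing v with
  | nil => simp at h
  | cons u l ih =>
    have ih := ih fun u' hu' => hl u' (List.mem_cons_of_mem _ hu')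
    rw [List.flatten_cons, List.append_eq_append_iff] at h
    rcases h with ⟨v', rfl, h⟩ | ⟨c, hu, h⟩
    · exact (ih v' h).imp (fun h' => h'.trans (List.suffix_append _ _)) id
    · cases c with
      | nil => exact (ih [] h.symm).imp (fun h' => by simp at h') id
      | cons b c =>
        obtain ⟨rfl, rfl⟩ : Letter.β = b ∧ w = c ++ l.flatten := by simpa using h
        have hu' := hl u List.mem_cons_self
        rw [hu] at hu'
        simp only [baseList, Set.mem_insert_iff, Set.mem_singleton_iff] at hu'
        rcases v with _ | ⟨v₁, _ | ⟨v₂, _ | ⟨v₃, v⟩⟩⟩ <;> simp at hu' ⊢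
        · simp [hu']
        · simp [hu']

variable {m : Letter → ℕ}

/-- Admissibility is a condition on the words of length five, hence it only requires the factors of
this length to be factors of concatenations. -/
theorem admissible_of_factors (x : ℤ → Fragmented m)
    (h : ∀ i, window x i 5 ∈ factors (fragment m baseList)) :
    Admissible fun i => (x i).1 := by
  intro i hi
  obtain ⟨_, ⟨l, hl, rfl⟩, s, t, hst⟩ := h (i - 2)
  have h1 := congrArg (List.map Sigma.fst) hst
  rw [List.map_flatten] at h1
  have h2 : window x (i - 2) 5 = [x (i - 2), x (i - 1), x i, x (i + 1), x (i + 2)] := by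
    simp only [window, List.ofFn_succ, List.ofFn_zero, sub_eq_add_neg i]
    norm_num [add_assoc]
  rw [h2] at h1
  have := suffix_or_prefix_of_flatten_eq (l.map (List.map Sigma.fst))
    (by simpa [fragment] using hl)
    (s.map Sigma.fst ++ [(x (i - 2)).1, (x (i - 1)).1])
    ((x (i + 1)).1 :: (x (i + 2)).1 :: t.map Sigma.fst) (by rw [← h1]; simp [hi])
  refine this.imp (fun h' => ?_) (fun h' => ?_)
  · obtain ⟨r, hr⟩ := h'
    have := (List.append_inj' hr rfl).2
    simp at this
    exact ⟨this.1.symm, this.2.symm⟩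
  · simp [List.cons_prefix_cons] at h'
    exact ⟨h'.1.symm, h'.2.symm⟩

/-- Places at which an admissible sequence can be cut: the words of the list can be split off
greedily from here on, preferring `αγβ` to `α` and giving `βα̃γ` for the other letters `β`.
The second condition says that the cut does not split a word `αγβ` after its first letter, unless
the letter `β` can be used for `βα̃γ`. -/
def IsCut (y : ℤ → Letter) (i : ℤ) : Prop :=
  (y i = .β → y (i + 1) = .αt ∧ y (i + 2) = .γ) ∧
  (y (i - 1) = .α → y i = .γ → y (i + 1) = .β → y (i + 2) = .αt ∧ y (i + 3) = .γ)

theorem Admissible.exists_isCut {y : ℤ → Letter} (hy : Admissible y) (i : ℤ) :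
    ∃ c : ℕ, IsCut y (i - c) := by
  by_cases h1 : y (i - 1) = .α
  · exact ⟨1, by simp [IsCut, h1]⟩
  by_cases h2 : y (i - 2) = .α
  · exact ⟨2, by simp [IsCut, h2]⟩
  refine ⟨0, ?_⟩
  have := hy i
  simp_all [IsCut]

/-- One word of the list can be split off at a cut, and leads to a cut again. -/
theorem Admissible.exists_next_isCut {y : ℤ → Letter} (hy : Admissible y) (i : ℤ)
    (hi : IsCut y i) : ∃ n : ℕ, 0 < n ∧ window y i n ∈ baseList ∧ IsCut y (i + n) := by
  have w1 : window y i 1 = [y i] := by simp [window]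
  have w3 : window y i 3 = [y i, y (i + 1), y (i + 2)] := by simp [window, List.ofFn_succ]
  have b1 := hy (i + 1)
  have b3 := hy (i + 3)
  obtain ⟨c1, c2⟩ := hi
  rw [show i + 1 - 2 = i - 1 by ring, show i + 1 - 1 = i by ring, show i + 1 + 1 = i + 2 by ring,
    show i + 1 + 2 = i + 3 by ring] at b1
  rw [show i + 3 - 2 = i + 1 by ring, show i + 3 - 1 = i + 2 by ring,
    show i + 3 + 1 = i + 4 by ring, show i + 3 + 2 = i + 5 by ring] at b3
  have cut1 : IsCut y (i + 1) ↔ (y (i + 1) = .β → y (i + 2) = .αt ∧ y (i + 3) = .γ) ∧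
      (y i = .α → y (i + 1) = .γ → y (i + 2) = .β → y (i + 3) = .αt ∧ y (i + 4) = .γ) := by
    simp only [IsCut, add_assoc, add_sub_assoc]; norm_num
  have cut3 : IsCut y (i + 3) ↔ (y (i + 3) = .β → y (i + 4) = .αt ∧ y (i + 5) = .γ) ∧
      (y (i + 2) = .α → y (i + 3) = .γ → y (i + 4) = .β →
        y (i + 5) = .αt ∧ y (i + 6) = .γ) := by
    simp only [IsCut, add_assoc, add_sub_assoc]; norm_num
  -- The words to split off are `βα̃γ`, then `αγβ`, then single letters.
  by_cases hβ : y i = .β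
  · refine ⟨3, by norm_num, ?_, ?_⟩
    · simp [w3, baseList, hβ, c1 hβ]
    · refine cut3.2 ⟨fun h => ?_, ?_⟩
      · simpa [c1 hβ] using b3 h
      · simp [c1 hβ]
  by_cases hα : y i = .α ∧ y (i + 1) = .γ ∧ y (i + 2) = .β
  · refine ⟨3, by norm_num, ?_, ?_⟩
    · simp [w3, baseList, hα]
    · refine cut3.2 ⟨fun h => ?_, ?_⟩
      · simpa [hα] using b3 h
      · simp [hα]
  refine ⟨1, by norm_num, ?_, ?_⟩
  · rw [w1]
    cases h : y i <;> simp_all [baseList]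
  · refine cut1.2 ⟨fun h => ?_, fun h1 h2 h3 => absurd ⟨h1, h2, h3⟩ hα⟩
    rcases b1 h with h' | h'
    · exact c2 h'.1 h'.2 h
    · exact h'

/-- From a cut on, an admissible sequence has arbitrarily long initial words that are
concatenations of words of the list. -/
theorem Admissible.exists_flatten_eq_window {x : ℤ → Fragmented m}
    (hx : Admissible fun i => (x i).1) (n : ℕ) (i : ℤ) (hi : IsCut (fun i => (x i).1) i) :
    ∃ k, n ≤ k ∧ ∃ l : List (List (Fragmented m)),
      (∀ u ∈ l, u ∈ fragment m baseList) ∧ window x i k = l.flatten := by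
  induction n generalizing i with
  | zero => exact ⟨0, le_rfl, [], by simp, by simp [window]⟩
  | succ n ih =>
    obtain ⟨r, hr, hw, hc⟩ := hx.exists_next_isCut i hi
    obtain ⟨k, hk, l, hl, hkl⟩ := ih _ hc
    refine ⟨r + k, by omega, window x i r :: l, ?_, by rw [window_add, hkl, List.flatten_cons]⟩
    simp only [List.mem_cons, forall_eq_or_imp]
    refine ⟨?_, hl⟩
    simpa [fragment, window, List.map_ofFn, Function.comp_def] using hw

theorem Admissible.mem_renewalSystem {x : ℤ → Fragmented m}
    (hx : Admissible fun i => (x i).1) :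
    x ∈ (renewalSystem (fragment m baseList)).carrier := by
  intro w hw
  obtain ⟨i, hi⟩ := (occurs_iff_eq_window w x).1 hw
  obtain ⟨c, hc⟩ := hx.exists_isCut i
  obtain ⟨k, hk, l, hl, hkl⟩ := hx.exists_flatten_eq_window (c + w.length) _ hc
  refine ⟨_, ⟨l, hl, rfl⟩, ?_⟩
  rw [← hkl, hi]
  simpa using window_infix x (i - c) c w.length k hk

theorem mem_renewalSystem_iff (x : ℤ → Fragmented m) :
    x ∈ (renewalSystem (fragment m baseList)).carrier ↔ Admissible fun i => (x i).1 :=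
  ⟨fun h => admissible_of_factors x fun i => h _ (occurs_window x i 5),
    fun h => h.mem_renewalSystem⟩

theorem finite_fragment_baseList (m : Letter → ℕ) : (fragment m baseList).Finite := by
  refine (List.finite_length_le (Fragmented m) 3).subset fun w hw => ?_
  simp only [fragment, baseList, Set.mem_ofPred_eq, Set.mem_insert_iff,
    Set.mem_singleton_iff] at hw
  have hlen := List.length_map (as := w) Sigma.fst
  change w.length ≤ 3
  rw [← hlen]
  rcases hw with h | h | h | h | h | h <;> simp [h]

theorem isSFT_renewalSystem (m : Letter → ℕ) :
    IsSFT (renewalSystem (fragment m baseList)) := by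
  refine ⟨{w | w.length = 5 ∧ w ∉ factors (fragment m baseList)},
    (List.finite_length_eq (Fragmented m) 5).subset fun w hw => hw.1, ?_⟩
  ext x
  refine ⟨fun h w hw ho => hw.2 (h w ho), fun h => ?_⟩
  refine (admissible_of_factors x fun i => ?_).mem_renewalSystem
  by_contra hn
  exact h _ ⟨by simp [window], hn⟩ (occurs_window x i 5)

/-! ### The automaton -/

/-- The automaton that reads the admissible sequences. In state `1` the last letter was `α`, and in
state `2` the last two letters were `αγ`; in state `3` the last letter was a `β` that must be
followed by `α̃γ`, and in state `4` the `α̃` of this word has been read. Otherwise the state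
is `0`. -/
def step : Fin 5 → Letter → Option (Fin 5)
  | 3, .αt => some 4
  | 3, _ => none
  | 4, .γ => some 0
  | 4, _ => none
  | _, .α => some 1
  | 1, .γ => some 2
  | 2, .β => some 0
  | _, .β => some 3
  | _, _ => some 0

/-- The state of the automaton after it has read the given four letters. -/
def state : Letter → Letter → Letter → Letter → Fin 5
  | _, _, _, .α => 1
  | _, _, .α, .γ => 2
  | _, .α, .γ, .β => 0
  | _, _, _, .β => 3
  | .α, .γ, .β, .αt => 0
  | _, _, .β, .αt => 4
  | _, _, _, _ => 0

/-- The two hypotheses are the conditions on an admissible sequence at the letters `b₃` and `b₄`,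
as far as these involve only the given letters. -/
theorem step_state (b₁ b₂ b₃ b₄ b : Letter)
    (h3 : b₃ = .β → (b₁ = .α ∧ b₂ = .γ) ∨ (b₄ = .αt ∧ b = .γ))
    (h4 : b₄ = .β → (b₂ = .α ∧ b₃ = .γ) ∨ b = .αt) :
    step (state b₁ b₂ b₃ b₄) b = some (state b₂ b₃ b₄ b) := by
  revert b₁ b₂ b₃ b₄ b
  set_option synthInstance.maxSize 1000 in
  decide +kernel

/-- After four steps the state does not depend on the state before them any more. -/
theorem eq_state_of_step (s₀ s₁ s₂ s₃ s₄ : Fin 5) (b₁ b₂ b₃ b₄ : Letter)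
    (h1 : step s₀ b₁ = some s₁) (h2 : step s₁ b₂ = some s₂) (h3 : step s₂ b₃ = some s₃)
    (h4 : step s₃ b₄ = some s₄) : s₄ = state b₁ b₂ b₃ b₄ := by
  have key : ∀ (s₀ : Fin 5) (b₁ b₂ b₃ b₄ : Letter), ∀ s ∈ ((((step s₀ b₁).bind
      (step · b₂)).bind (step · b₃)).bind (step · b₄)), s = state b₁ b₂ b₃ b₄ := by
    decide +kernel
  exact key s₀ b₁ b₂ b₃ b₄ s₄ (by simp [h1, h2, h3, h4])

theorem admissible_of_step (s₀ s₁ s₂ s₃ s₄ s₅ : Fin 5) (b₁ b₂ b₄ b₅ : Letter)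
    (h1 : step s₀ b₁ = some s₁) (h2 : step s₁ b₂ = some s₂) (h3 : step s₂ .β = some s₃)
    (h4 : step s₃ b₄ = some s₄) (h5 : step s₄ b₅ = some s₅) :
    (b₁ = .α ∧ b₂ = .γ) ∨ (b₄ = .αt ∧ b₅ = .γ) := by
  have key : ∀ (s₀ : Fin 5) (b₁ b₂ b₄ b₅ : Letter), ∀ s ∈ (((((step s₀ b₁).bind
      (step · b₂)).bind (step · .β)).bind (step · b₄)).bind (step · b₅)),
      (b₁ = .α ∧ b₂ = .γ) ∨ (b₄ = .αt ∧ b₅ = .γ) := by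
    decide +kernel
  exact key s₀ b₁ b₂ b₄ b₅ s₅ (by simp [h1, h2, h3, h4, h5])

theorem conjugate_renewalSystem (m : Letter → ℕ) :
    Conjugate (renewalSystem (fragment m baseList))
      (edgeShift (transitionMatrix fun s (b : Fragmented m) => step s b.1)) := by
  refine conjugate_edgeShift_transitionMatrix _ _
    (fun x => state (x (-4)).1 (x (-3)).1 (x (-2)).1 (x (-1)).1) ?_ ?_ ?_
  · have h : Continuous fun r : Fragmented m × Fragmented m × Fragmented m × Fragmented m =>
        state r.1.1 r.2.1.1 r.2.2.1.1 r.2.2.2.1 := continuous_of_discreteTopology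
    exact h.comp (f := fun x : ℤ → Fragmented m => (x (-4), x (-3), x (-2), x (-1))) (by fun_prop)
  · intro x hx i
    have h := (mem_renewalSystem_iff x).1 hx
    have h2 := h (i - 2)
    have h1 := h (i - 1)
    ring_nf at h1 h2
    simp only [shift_apply]
    ring_nf
    exact step_state _ _ _ _ _ h2 fun hb => (h1 hb).imp id And.left
  · intro x t ht
    refine ⟨(mem_renewalSystem_iff x).2 fun i hi => ?_, fun i => ?_⟩
    · have h1 := ht (i - 2)
      have h2 := ht (i - 1)
      have h3 := ht i
      have h4 := ht (i + 1)
      have h5 := ht (i + 2)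
      simp only at hi
      rw [hi] at h3
      ring_nf at h1 h2 h3 h4 h5 ⊢
      exact admissible_of_step _ _ _ _ _ _ _ _ _ _ h1 h2 h3 h4 h5
    · have h1 := ht (i - 4)
      have h2 := ht (i - 3)
      have h3 := ht (i - 2)
      have h4 := ht (i - 1)
      simp only [shift_apply]
      ring_nf at h1 h2 h3 h4 ⊢
      exact eq_state_of_step _ _ _ _ _ _ _ _ _ h1 h2 h3 h4

/-! ### The Bowen–Franks group and the determinant -/

theorem transitionMatrix_fragmented {V : Type*} [DecidableEq V] (m : Letter → ℕ)
    (δ : V → Letter → Option V) (i j : V) :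
    transitionMatrix (fun s (b : Fragmented m) => δ s b.1) i j =
      ∑ l, if δ i l = some j then m l else 0 := by
  classical
  rw [transitionMatrix, Nat.card_congr (Equiv.subtypeSigmaEquiv (fun l => Fin (m l))
    fun l => δ i l = some j), Nat.card_sigma, ← Finset.sum_filter]
  simp only [Nat.card_eq_fintype_card, Fintype.card_fin]
  exact (Finset.sum_subtype _ (by simp) m).symm

theorem idSub_transitionMatrix (p q : ℕ) :
    idSub (transitionMatrix fun s (b : Fragmented (mult p q)) => step s b.1) =
      !![-(p : ℤ) - q, -1, 0, -1, 0;
         -(p : ℤ) - 1, 0, -(q : ℤ), -1, 0;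
         -(p : ℤ) - q - 2, -1, 1, 0, 0;
         0, 0, 0, 1, -1;
         -(q : ℤ), 0, 0, 0, 1] := by
  have univ : (Finset.univ : Finset Letter) = {.a, .α, .αt, .β, .γ} := rfl
  ext i j
  simp only [idSub, Matrix.sub_apply, Matrix.map_apply, transitionMatrix_fragmented, univ]
  fin_cases i <;> fin_cases j <;> simp [step, mult] <;> ring

theorem isAddCyclic_bowenFranks (p q : ℕ) :
    IsAddCyclic (BowenFranks
      (transitionMatrix fun s (b : Fragmented (mult p q)) => step s b.1)) := by
  refine ⟨Submodule.Quotient.mk (Pi.single 0 1), fun z => ?_⟩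
  obtain ⟨v, rfl⟩ := Submodule.Quotient.mk_surjective _ z
  -- A row combination `w` without the second row which agrees with `v` outside coordinate `0`.
  let w : Fin 5 → ℤ :=
    ![-v 1 - v 2, 0, v 2, v 3 - v 1 - v 2, v 4 + (v 3 - v 1 - v 2)]
  let M := idSub (transitionMatrix fun s (b : Fragmented (mult p q)) => step s b.1)
  refine ⟨v 0 - (Matrix.vecMul w M) 0, ?_⟩
  change (_ : ℤ) • Submodule.Quotient.mk _ = _
  rw [← Submodule.Quotient.mk_smul, Submodule.Quotient.eq]
  refine ⟨-w, ?_⟩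
  rw [Matrix.vecMulLinear_apply, Matrix.neg_vecMul]
  change -Matrix.vecMul w M = _
  ext j
  simp only [M, idSub_transitionMatrix]
  fin_cases j <;> simp [w, Matrix.vecMul, dotProduct, Fin.sum_univ_succ] <;> ring

theorem det_idSub_transitionMatrix (p q : ℕ) :
    (idSub (transitionMatrix fun s (b : Fragmented (mult p q)) => step s b.1)).det =
      (q : ℤ) ^ 2 - 3 * q - p - 1 := by
  rw [idSub_transitionMatrix]
  simp [Matrix.det_succ_row_zero, Fin.sum_univ_succ, Fin.succAbove]
  ring

theorem hasCyclicBFAndDet_renewalSystem (p q : ℕ) :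
    HasCyclicBFAndDet (renewalSystem (fragment (mult p q) baseList))
      ((q : ℤ) ^ 2 - 3 * q - p - 1) :=
  ⟨5, _, conjugate_renewalSystem _, isAddCyclic_bowenFranks p q, det_idSub_transitionMatrix p q⟩

/-- Every integer is a value of the determinant. -/
theorem exists_eq_det (k : ℤ) :
    ∃ p q : ℕ, 1 ≤ p ∧ 1 ≤ q ∧ (q : ℤ) ^ 2 - 3 * q - p - 1 = k := by
  -- For `q = |k| + 4` the value `q ^ 2 - 3 * q - 1 = k ^ 2 + 5 * |k| + 3` exceeds `k`.
  have hk : k ≤ k.natAbs := Int.le_natAbs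
  have hp : 1 ≤ ((k.natAbs + 4 : ℕ) : ℤ) ^ 2 - 3 * (k.natAbs + 4 : ℕ) - 1 - k := by
    push_cast [-Int.natCast_natAbs]
    nlinarith [Int.natCast_nonneg k.natAbs]
  obtain ⟨p, hp'⟩ := Int.eq_ofNat_of_zero_le (zero_le_one.trans hp)
  exact ⟨p, k.natAbs + 4, by omega, by omega, by rw [← Int.ofNat_eq_natCast] at *; linarith⟩

end RenewalSystems

theorem mainTheorem3 :
    (∀ k : ℤ, ∃ (𝒜 : Type) (_ : Finite 𝒜) (_ : TopologicalSpace 𝒜) (_ : DiscreteTopology 𝒜)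
      (L : Set (List 𝒜)), L.Finite ∧
        RenewalSystems.IsSFT (RenewalSystems.renewalSystem L) ∧
        RenewalSystems.HasCyclicBFAndDet (RenewalSystems.renewalSystem L) k) ∧
    (∀ p q : ℕ, 1 ≤ p → 1 ≤ q →
      (RenewalSystems.fragment (RenewalSystems.mult p q) RenewalSystems.baseList).Finite ∧
      RenewalSystems.IsSFT (RenewalSystems.renewalSystem
        (RenewalSystems.fragment (RenewalSystems.mult p q) RenewalSystems.baseList)) ∧
      RenewalSystems.HasCyclicBFAndDet (RenewalSystems.renewalSystem
        (RenewalSystems.fragment (RenewalSystems.mult p q) RenewalSystems.baseList))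
        ((q : ℤ) ^ 2 - 3 * q - p - 1)) ∧
    (∀ k : ℤ, ∃ p q : ℕ, 1 ≤ p ∧ 1 ≤ q ∧ (q : ℤ) ^ 2 - 3 * q - p - 1 = k) := by
  refine ⟨fun k => ?_, fun p q _ _ => ⟨RenewalSystems.finite_fragment_baseList _,
    RenewalSystems.isSFT_renewalSystem _, RenewalSystems.hasCyclicBFAndDet_renewalSystem p q⟩,
    RenewalSystems.exists_eq_det⟩
  obtain ⟨p, q, _, _, rfl⟩ := RenewalSystems.exists_eq_det k
  exact ⟨RenewalSystems.Fragmented (RenewalSystems.mult p q), inferInstance, inferInstance,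
    inferInstance, _, RenewalSystems.finite_fragment_baseList _,
    RenewalSystems.isSFT_renewalSystem _, RenewalSystems.hasCyclicBFAndDet_renewalSystem p q⟩
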